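/- Let $K$ denote prefix-free Kolmogorov complexity of finite binary strings (taken with respect to any fixed optimal prefix-free machine). For an infinite binary sequence $X\in 2^\omega$ let \[ \dim(X)=\liminf_{n\to\infty}\frac{K(X\restriction n)}{n} \] be its effective Hausdorff dimension, where $X\restriction n$ is the $n$-bit prefix of $X$. For $X,Y\in 2^\omega$ let \[ d(X,Y)=\limsup_{n\to\infty}\frac{\#\{k<n : X(k)\neq Y(k)\}}{n} \] be their Besicovitch distance. Let $H(p)=-(p\log_2 p+(1-p)\log_2(1-p))$ be the binary entropy function on $[0,1]$ (with $0\log_2 0=0$), and let $H^{-1}:[0,1]\to[0,1/2]$ be the inverse of the restriction of $H$ to $[0,1/2]$. **Theorem.** For every $s\in[0,1]$ and every $Y\in 2^\omega$ there is some $X\in 2^\omega$ such that \[ \dim(X)\le s\qquad\text{and}\qquad d(X,Y)\le H^{-1}(1-s). \] -/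

import Mathlib

/-! ### Prefix-free machines and prefix-free Kolmogorov complexity -/

/-- A prefix-free machine: a partial computable function from binary strings to binary strings
such that no string of its domain is a proper prefix of another one. -/
structure IsPrefixFreeMachine (M : List Bool →. List Bool) : Prop where
  partrec : Partrec M
  prefixFree : ∀ p q : List Bool, (M p).Dom → (M q).Dom → p <+: q → p = q

/-- The complexity of the string `σ` with respect to the machine `M`: the least length of a
program `p` with `M p = σ` (and `⊤` if there is none). -/
noncomputable def machineComplexity (M : List Bool →. List Bool) (σ : List Bool) : ℕ∞ :=
  ⨅ p ∈ {p : List Bool | σ ∈ M p}, (p.length : ℕ∞)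

/-- An optimal (universal) prefix-free machine: a prefix-free machine whose complexity is minimal,
up to an additive constant, among all prefix-free machines. The prefix-free Kolmogorov complexity
is `K σ = machineComplexity U σ` for such a machine `U`. -/
structure IsOptimalPrefixFreeMachine (U : List Bool →. List Bool) : Prop
    extends IsPrefixFreeMachine U where
  optimal : ∀ M : List Bool →. List Bool, IsPrefixFreeMachine M →
    ∃ c : ℕ, ∀ σ : List Bool, machineComplexity U σ ≤ machineComplexity M σ + c

/-! ### Existence of an optimal prefix-free machine

A program `1ᵉ0p` runs the `e`-th partial computable function on `p`, and halts only at a stage at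
which no other string comparable with `p` has been seen to halt. -/

namespace OptimalMachine

open Encodable Denumerable Nat.Partrec

/-- The number of leading ones. -/
def header (l : List Bool) : ℕ := (l.takeWhile id).length

/-- What comes after the leading ones and the zero that ends them. -/
def payload (l : List Bool) : List Bool := l.drop (header l + 1)

/-- The string with code `m`, or `p` if there is none. -/
def strOr (p : List Bool) (m : ℕ) : List Bool := (decode m : Option (List Bool)).getD p

/-- `m` codes a string other than `p`, comparable with `p`, on which `c` halts by stage `k`. -/
def Conflict (c : Code) (p : List Bool) (k m : ℕ) : Prop :=
  (strOr p m ≠ p ∧ ((strOr p m).take p.length = p ∨ p.take (strOr p m).length = strOr p m)) ∧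
    (c.evaln k m).isSome = true

instance (c : Code) (p : List Bool) (k m : ℕ) : Decidable (Conflict c p k m) := by
  unfold Conflict; infer_instance

/-- The computation of the optimal machine on input `l`, up to stage `k`. -/
def stage (l : List Bool) (k : ℕ) : Option (List Bool) :=
  if header l < l.length ∧ ∀ m < k, ¬ Conflict (ofNat Code (header l)) (payload l) k m then
    ((ofNat Code (header l)).evaln k (encode (payload l))).bind decode
  else none

/-- The optimal machine. -/
def machine : List Bool →. List Bool := fun l => Nat.rfindOpt (stage l)

theorem primrec_header : Primrec header :=
  Primrec.list_length.comp (Primrec.list_takeWhile Primrec.id)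

theorem primrec_payload : Primrec payload :=
  Primrec.list_drop.comp (Primrec.succ.comp primrec_header) Primrec.id

theorem primrec_strOr : Primrec₂ strOr :=
  Primrec.option_getD.comp (Primrec.decode.comp Primrec.snd) Primrec.fst

theorem primrec_conflict :
    PrimrecRel fun (m : ℕ) (a : List Bool × ℕ) =>
      ¬ Conflict (ofNat Code (header a.1)) (payload a.1) a.2 m := by
  have hp : Primrec fun x : ℕ × (List Bool × ℕ) => payload x.2.1 :=
    primrec_payload.comp (Primrec.fst.comp Primrec.snd)
  have hs : Primrec fun x : ℕ × (List Bool × ℕ) => strOr (payload x.2.1) x.1 :=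
    primrec_strOr.comp hp Primrec.fst
  have hc : Primrec fun x : ℕ × (List Bool × ℕ) => ofNat Code (header x.2.1) :=
    (Primrec.ofNat Code).comp (primrec_header.comp (Primrec.fst.comp Primrec.snd))
  have he : Primrec fun x : ℕ × (List Bool × ℕ) =>
      Code.evaln x.2.2 (ofNat Code (header x.2.1)) x.1 :=
    Code.primrec_evaln.comp
      (((Primrec.snd.comp Primrec.snd).pair hc).pair Primrec.fst)
  have h1 : PrimrecPred fun x : ℕ × (List Bool × ℕ) =>
      Conflict (ofNat Code (header x.2.1)) (payload x.2.1) x.2.2 x.1 :=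
    ((Primrec.eq.comp hs hp).not.and
      ((Primrec.eq.comp (Primrec.list_take.comp (Primrec.list_length.comp hp) hs) hp).or
        (Primrec.eq.comp (Primrec.list_take.comp (Primrec.list_length.comp hs) hp) hs))).and
      (Primrec.eq.comp (Primrec.option_isSome.comp he) (Primrec.const true))
  exact h1.not

theorem primrec_stage : Primrec₂ stage := by
  have hfst : Primrec fun a : List Bool × ℕ => a.1 := Primrec.fst
  have hh : Primrec fun a : List Bool × ℕ => header a.1 := primrec_header.comp hfst
  have h1 : PrimrecPred fun a : List Bool × ℕ => header a.1 < a.1.length :=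
    Primrec.nat_lt.comp hh (Primrec.list_length.comp hfst)
  have h2 : PrimrecPred fun a : List Bool × ℕ =>
      ∀ m < a.2, ¬ Conflict (ofNat Code (header a.1)) (payload a.1) a.2 m :=
    ((PrimrecRel.forall_mem_list primrec_conflict).comp
      (Primrec.list_range.comp (Primrec.snd (α := List Bool) (β := ℕ))) Primrec.id).of_eq
        (fun a => by simp)
  have he : Primrec fun a : List Bool × ℕ =>
      Code.evaln a.2 (ofNat Code (header a.1)) (encode (payload a.1)) :=
    Code.primrec_evaln.comp ((Primrec.snd.pair ((Primrec.ofNat Code).comp hh)).pair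
      (Primrec.encode.comp (primrec_payload.comp hfst)))
  exact Primrec.ite (h1.and h2)
    (Primrec.option_bind he (Primrec.decode.comp Primrec.snd).to₂) (Primrec.const none)

theorem stage_spec {l σ : List Bool} {k : ℕ} (h : σ ∈ stage l k) :
    header l < l.length ∧
      (∀ m < k, ¬ Conflict (ofNat Code (header l)) (payload l) k m) ∧
      ∃ x ∈ (ofNat Code (header l)).evaln k (encode (payload l)), decode x = some σ := by
  unfold stage at h
  split_ifs at h with hc
  · exact ⟨hc.1, hc.2, by simpa [Option.bind_eq_some_iff] using h⟩
  · simp at h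

theorem eq_of_header_lt {l : List Bool} (h : header l < l.length) :
    l = List.replicate (header l) true ++ false :: payload l := by
  induction l with
  | nil => simp at h
  | cons b l ih =>
    cases b with
    | false => simp [header, payload]
    | true =>
      have h1 : header (true :: l) = header l + 1 := by simp [header]
      have h2 : payload (true :: l) = payload l := by simp [payload, h1]
      rw [h1, h2, List.replicate_succ, List.cons_append, ← ih (by rw [h1] at h; simpa using h)]

theorem header_append (e : ℕ) (p : List Bool) :
    header (List.replicate e true ++ false :: p) = e := by
  induction e with
  | zero => simp [header]
  | succ e ih =>
    rw [List.replicate_succ, List.cons_append]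
    simp [header]

theorem payload_append (e : ℕ) (p : List Bool) :
    payload (List.replicate e true ++ false :: p) = p := by
  rw [payload, header_append, List.drop_append]
  simp

theorem conflict_of_comparable {c : Code} {p q : List Bool} {k x : ℕ} (hne : q ≠ p)
    (hpq : p <+: q ∨ q <+: p) (hx : x ∈ c.evaln k (encode q)) :
    Conflict c p k (encode q) := by
  have hs : strOr p (encode q) = q := by simp [strOr]
  refine ⟨?_, ?_⟩
  · rw [hs]
    refine ⟨hne, ?_⟩
    rcases hpq with h | h
    · exact Or.inl (List.prefix_iff_eq_take.1 h).symm
    · exact Or.inr (List.prefix_iff_eq_take.1 h).symm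
  · rw [Option.mem_def.1 hx]; rfl

theorem machine_prefixFree (l₁ l₂ : List Bool) (h₁ : (machine l₁).Dom) (h₂ : (machine l₂).Dom)
    (h : l₁ <+: l₂) : l₁ = l₂ := by
  obtain ⟨k₁, σ₁, hk₁⟩ := Nat.rfindOpt_dom.1 h₁
  obtain ⟨k₂, σ₂, hk₂⟩ := Nat.rfindOpt_dom.1 h₂
  obtain ⟨hl₁, hc₁, x₁, hx₁, -⟩ := stage_spec hk₁
  obtain ⟨hl₂, hc₂, x₂, hx₂, -⟩ := stage_spec hk₂
  have e₁ := eq_of_header_lt hl₁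
  have e₂ := eq_of_header_lt hl₂
  obtain ⟨t, ht⟩ := h
  have e₃ : l₂ = List.replicate (header l₁) true ++ false :: (payload l₁ ++ t) := by
    conv_lhs => rw [← ht, e₁]
    simp
  have hh : header l₂ = header l₁ := by
    conv_lhs => rw [e₃]
    exact header_append _ _
  have hp : payload l₁ ++ t = payload l₂ := by
    conv_rhs => rw [e₃]
    exact (payload_append _ _).symm
  have hpre : payload l₁ <+: payload l₂ := ⟨t, hp⟩
  have key : payload l₁ = payload l₂ := by
    by_contra hne
    rw [hh] at hx₂ hc₂
    rcases le_total k₁ k₂ with hk | hk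
    · have := Code.evaln_mono hk hx₁
      exact hc₂ _ (Code.evaln_bound this)
        (conflict_of_comparable hne (Or.inr hpre) this)
    · have := Code.evaln_mono hk hx₂
      exact hc₁ _ (Code.evaln_bound this)
        (conflict_of_comparable (Ne.symm hne) (Or.inl hpre) this)
  rw [e₁, e₂, hh, key]

theorem isPrefixFreeMachine_machine : IsPrefixFreeMachine machine :=
  ⟨Partrec.rfindOpt primrec_stage.to_comp, machine_prefixFree⟩

theorem exists_simulation {M : List Bool →. List Bool} (hM : IsPrefixFreeMachine M) :
    ∃ e : ℕ, ∀ p σ : List Bool, σ ∈ M p →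
      σ ∈ machine (List.replicate e true ++ false :: p) := by
  obtain ⟨c, hc⟩ := Code.exists_code.1 hM.partrec
  have heval : ∀ m x, x ∈ c.eval m ↔
      ∃ q : List Bool, decode m = some q ∧ ∃ σ ∈ M q, encode σ = x := by
    intro m x
    rw [hc]
    simp
  refine ⟨encode c, fun p σ hσ => ?_⟩
  set l := List.replicate (encode c) true ++ false :: p with hl
  have hh : header l = encode c := header_append _ _
  have hp : payload l = p := payload_append _ _
  have hnc : ∀ k m, ¬ Conflict c p k m := by
    rintro k m ⟨⟨hne, hcomp⟩, hsome⟩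
    obtain ⟨x, hx⟩ := Option.isSome_iff_exists.1 hsome
    obtain ⟨q, hq, τ, hτ, -⟩ := (heval m x).1 (Code.evaln_sound hx)
    have hs : strOr p m = q := by simp [strOr, hq]
    rw [hs] at hne hcomp
    have hqd : (M q).Dom := Part.dom_iff_mem.2 ⟨τ, hτ⟩
    have hpd : (M p).Dom := Part.dom_iff_mem.2 ⟨σ, hσ⟩
    rcases hcomp with h | h
    · exact hne (hM.prefixFree p q hpd hqd (List.prefix_iff_eq_take.2 h.symm)).symm
    · exact hne (hM.prefixFree q p hqd hpd (List.prefix_iff_eq_take.2 h.symm))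
  have hstage : ∀ k, stage l k = (c.evaln k (encode p)).bind decode := by
    intro k
    rw [stage, hh, hp, ofNat_encode, if_pos]
    exact ⟨by simp [hl], fun m _ => hnc k m⟩
  have hmem : ∃ k, σ ∈ stage l k := by
    obtain ⟨k, hk⟩ := Code.evaln_complete.1
      ((heval (encode p) (encode σ)).2 ⟨p, encodek p, σ, hσ, rfl⟩)
    refine ⟨k, ?_⟩
    rw [hstage, Option.mem_def.1 hk]
    simp
  refine (Nat.rfindOpt_mono ?_).2 hmem
  intro τ m n hmn hτ
  rw [hstage] at hτ ⊢
  obtain ⟨x, hx, hd⟩ := Option.bind_eq_some_iff.1 hτ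
  exact Option.bind_eq_some_iff.2 ⟨x, Code.evaln_mono hmn hx, hd⟩

end OptimalMachine

/-- There is an optimal prefix-free machine. -/
theorem exists_isOptimalPrefixFreeMachine :
    ∃ U : List Bool →. List Bool, IsOptimalPrefixFreeMachine U := by
  refine ⟨OptimalMachine.machine, OptimalMachine.isPrefixFreeMachine_machine, fun M hM => ?_⟩
  obtain ⟨e, he⟩ := OptimalMachine.exists_simulation hM
  refine ⟨e + 1, fun σ => ?_⟩
  by_cases hσ : ∃ p, σ ∈ M p
  · obtain ⟨p₀, hp₀⟩ := hσ
    unfold machineComplexity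
    have : Nonempty {p : List Bool | σ ∈ M p} := ⟨⟨p₀, hp₀⟩⟩
    rw [iInf_subtype', iInf_subtype', ENat.iInf_add]
    refine le_iInf fun p => ?_
    refine (iInf_le _ ⟨_, he p.1 σ p.2⟩).trans ?_
    simp only [List.length_append, List.length_replicate, List.length_cons]
    norm_cast
    omega
  · have : machineComplexity M σ = ⊤ := by
      unfold machineComplexity
      simp only [iInf_eq_top]
      exact fun p hp => (hσ ⟨p, hp⟩).elim
    rw [this]
    simp

/-! ### Effective dimension, Besicovitch distance and the binary entropy function -/

/-- The `n`-bit prefix of the infinite binary sequence `X`. -/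
def bitPrefix (X : ℕ → Bool) (n : ℕ) : Fin n → Bool := fun i => X i

/-- The effective Hausdorff dimension `liminf K(X↾n) / n` of the infinite binary sequence `X`,
where `K` is the complexity with respect to the optimal prefix-free machine `U`. -/
noncomputable def effectiveDim (U : List Bool →. List Bool) (X : ℕ → Bool) : ENNReal :=
  Filter.liminf
    (fun n : ℕ => (machineComplexity U (List.ofFn (bitPrefix X n)) : ENNReal) / (n : ENNReal))
    Filter.atTop

/-- The normalised Hamming distance on binary strings of length `n`. -/
noncomputable def normalizedHammingDist {n : ℕ} (σ τ : Fin n → Bool) : ℝ :=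
  (hammingDist σ τ : ℝ) / n

/-- The Besicovitch distance on Cantor space. -/
noncomputable def besicovitchDist (X Y : ℕ → Bool) : ℝ :=
  Filter.limsup (fun n : ℕ => normalizedHammingDist (bitPrefix X n) (bitPrefix Y n)) Filter.atTop

/-- The binary entropy function, with logarithms to base two. -/
noncomputable def binEntropyTwo (p : ℝ) : ℝ :=
  -(p * Real.logb 2 p + (1 - p) * Real.logb 2 (1 - p))

/-- The inverse of the binary entropy function, in the branch from `[0, 1]` to `[0, 1/2]`. -/
noncomputable def binEntropyTwoInv : ℝ → ℝ :=
  Function.invFunOn binEntropyTwo (Set.Icc 0 (1 / 2))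

theorem binEntropyTwo_eq (p : ℝ) : binEntropyTwo p = Real.binEntropy p / Real.log 2 := by
  simp only [binEntropyTwo, Real.binEntropy, Real.logb, Real.log_inv]
  ring

/-- The binary entropy function maps `[0, 1/2]` bijectively onto `[0, 1]`, so that
`binEntropyTwoInv` is its inverse there. -/
theorem bijOn_binEntropyTwo : Set.BijOn binEntropyTwo (Set.Icc 0 (1 / 2)) (Set.Icc 0 1) := by
  have hlog : 0 < Real.log 2 := Real.log_pos (by norm_num)
  have h0 : binEntropyTwo 0 = 0 := by simp [binEntropyTwo]
  have h1 : binEntropyTwo (1 / 2) = 1 := by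
    rw [binEntropyTwo_eq, one_div, Real.binEntropy_two_inv, div_self hlog.ne']
  have hmono : StrictMonoOn binEntropyTwo (Set.Icc 0 (1 / 2)) := by
    intro a ha b hb hab
    rw [binEntropyTwo_eq, binEntropyTwo_eq]
    rw [one_div] at ha hb
    exact div_lt_div_of_pos_right (Real.binEntropy_strictMonoOn ha hb hab) hlog
  have hcont : Continuous binEntropyTwo := by
    have : binEntropyTwo = fun p => Real.binEntropy p / Real.log 2 := funext binEntropyTwo_eq
    rw [this]
    fun_prop
  refine ⟨fun p hp => ?_, hmono.injOn, ?_⟩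
  · rw [← h0, ← h1]
    exact ⟨hmono.monotoneOn (by norm_num) hp hp.1, hmono.monotoneOn hp (by norm_num) hp.2⟩
  · have := intermediate_value_Icc (by norm_num : (0 : ℝ) ≤ 1 / 2) hcont.continuousOn
    rwa [h0, h1] at this

/-!
Put `p = H⁻¹(1 - s)`. For every `δ > 0` some block length `m` admits a covering code of radius `p m`
with `2ᵇ` words, where `(b + 1) / m ≤ s + δ` (`exists_coveringCode`). It is found greedily: a random
word is within distance `k = ⌊p m⌋` of a given one with probability at least `C(m, k) / 2ᵐ`, so about
`m 2ᵐ / C(m, k)` words suffice (`exists_cover_of_log_lt`), and `C(m, k) ≥ 2 ^ (m H(k / m)) / (m + 1)`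
because `C(m, k)` belongs to the largest term of the binomial expansion of `(k + (m - k)) ^ m`
(`rpow_binEntropyTwo_le_mul_choose`).

The sequence `X` is built in stages. In each stage the blocks of `Y` are replaced by nearby words of
one code, so that at most a fraction `p` of the bits is changed up to the end of each block. The
dimension is a lower limit, hence it is enough to bound the complexity of `X` at the ends of the
stages. This removes all questions of uniformity: the code and the finite part of `X` built so far
may be wired into a prefix-free machine that reads nothing but the indices of the code words
(`codebookMachine`). The resulting additive constant depends on the stage, and it becomes negligible
when the stage is made long enough (`exists_extension`). A stage is also made long compared with the
block length of the next one, so that incomplete blocks do not affect the Besicovitch distance.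
-/

/-! ### Binomial coefficients and entropy -/

/-- The binomial term `C(k + l, i) kⁱ lᵏ⁺ˡ⁻ⁱ` is largest at `i = k`: the quotient of the terms at
`i + 1` and at `i` is `(k + l - i) k / ((i + 1) l)`, which is at least one exactly when `i < k`. -/
theorem choose_mul_pow_mul_pow_le (k l i : ℕ) (hi : i ≤ k + l) :
    (k + l).choose i * k ^ i * l ^ (k + l - i) ≤ (k + l).choose k * k ^ k * l ^ l := by
  rcases Nat.eq_zero_or_pos l with rfl | hl
  · rcases hi.eq_or_lt with rfl | h
    · simp
    · rw [zero_pow (by omega), mul_zero]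
      exact Nat.zero_le _
  set t : ℕ → ℕ := fun i => (k + l).choose i * k ^ i * l ^ (k + l - i) with ht
  have step : ∀ i < k + l, t (i + 1) * ((i + 1) * l) = t i * ((k + l - i) * k) := by
    intro i hi
    have h1 : k + l - i = (k + l - (i + 1)) + 1 := by omega
    have h2 := Nat.choose_succ_right_eq (k + l) i
    calc t (i + 1) * ((i + 1) * l)
        = ((k + l).choose (i + 1) * (i + 1)) * (k ^ i * k) * (l ^ (k + l - (i + 1)) * l) := by
          simp only [ht]; ring
      _ = t i * ((k + l - i) * k) := by
          rw [h2, ← pow_succ l, ← h1]; simp only [ht]; ring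
  have up : ∀ i < k, t i ≤ t (i + 1) := by
    intro i hi
    refine Nat.le_of_mul_le_mul_right (c := (i + 1) * l) ?_ (by positivity)
    rw [step i (by omega)]
    refine Nat.mul_le_mul_left _ ?_
    obtain ⟨d, rfl⟩ := Nat.exists_eq_add_of_lt hi
    have : i + d + 1 + l - i = d + 1 + l := by omega
    rw [this]
    nlinarith [Nat.zero_le (d * d), Nat.zero_le (d * i), Nat.zero_le (d * l)]
  have down : ∀ i, k ≤ i → i < k + l → t (i + 1) ≤ t i := by
    intro i hki hi
    refine Nat.le_of_mul_le_mul_right (c := (i + 1) * l) ?_ (by positivity)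
    rw [step i hi]
    refine Nat.mul_le_mul_left _ ?_
    obtain ⟨d, rfl⟩ := Nat.exists_eq_add_of_le hki
    have : k + l - (k + d) ≤ l := by omega
    nlinarith [Nat.mul_le_mul_right k this, Nat.zero_le (d * l)]
  have key : t i ≤ t k := by
    rcases le_total i k with h | h
    · have : ∀ d i, i + d = k → t i ≤ t k := by
        intro d
        induction d with
        | zero => rintro i rfl; rfl
        | succ d ih => exact fun i h => (up i (by omega)).trans (ih (i + 1) (by omega))
      exact this (k - i) i (by omega)
    · induction i, h using Nat.le_induction with
      | base => rfl
      | succ j hj ih => exact (down j hj (by omega)).trans (ih (by omega))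
  simpa [ht] using key

theorem add_pow_add_le_mul_choose (k l : ℕ) :
    (k + l) ^ (k + l) ≤ (k + l + 1) * ((k + l).choose k * k ^ k * l ^ l) := by
  rw [add_pow]
  refine (Finset.sum_le_card_nsmul _ _ ((k + l).choose k * k ^ k * l ^ l) fun i hi => ?_).trans
    (by simp)
  have hi' : i ≤ k + l := by simpa [Nat.lt_succ_iff] using hi
  refine le_trans (le_of_eq ?_) (choose_mul_pow_mul_pow_le k l i hi')
  simp only [Nat.cast_id]
  ring

/-- A Hamming sphere of radius `k` in `{0, 1}ᵐ` has at least `2 ^ (m H(k / m)) / (m + 1)` points. -/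
theorem rpow_binEntropyTwo_le_mul_choose {m k : ℕ} (hm : 0 < m) (hk : k ≤ m) :
    (2 : ℝ) ^ ((m : ℝ) * binEntropyTwo (k / m)) ≤ (m + 1) * m.choose k := by
  obtain ⟨l, rfl⟩ := Nat.exists_eq_add_of_le hk
  have hC : (0 : ℝ) < (k + l).choose k := by exact_mod_cast Nat.choose_pos hk
  have hM : (0 : ℝ) < k + l := by exact_mod_cast hm
  have hpow : ∀ j : ℕ, (0 : ℝ) < (j : ℝ) ^ j := by
    intro j
    rcases Nat.eq_zero_or_pos j with rfl | h
    · simp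
    · positivity
  have hmain : ((k : ℝ) + l) ^ (k + l) ≤
      (k + l + 1) * ((k + l).choose k * (k : ℝ) ^ k * (l : ℝ) ^ l) := by
    exact_mod_cast add_pow_add_le_mul_choose k l
  have hlog := Real.log_le_log (by positivity) hmain
  rw [Real.log_mul (by positivity) (mul_pos (mul_pos hC (hpow k)) (hpow l)).ne',
    Real.log_mul (mul_pos hC (hpow k)).ne' (hpow l).ne',
    Real.log_mul hC.ne' (hpow k).ne', Real.log_pow, Real.log_pow, Real.log_pow] at hlog
  have hterm : ∀ j : ℕ, (j : ℝ) * Real.log (j / (k + l)) =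
      j * Real.log j - j * Real.log (k + l) := by
    intro j
    rcases Nat.eq_zero_or_pos j with rfl | h
    · simp
    · rw [Real.log_div (by positivity) hM.ne']; ring
  have hent : ((k : ℝ) + l) * Real.binEntropy (k / (k + l)) =
      ((k + l : ℕ) : ℝ) * Real.log (k + l) - k * Real.log k - l * Real.log l := by
    have h1 : 1 - (k : ℝ) / (k + l) = l / (k + l) := by field_simp; ring
    have h2 : ((k : ℝ) + l) * (k / (k + l)) = k := by field_simp
    have h3 : ((k : ℝ) + l) * (l / (k + l)) = l := by field_simp
    rw [Real.binEntropy, h1, Real.log_inv, Real.log_inv, mul_add, ← mul_assoc, ← mul_assoc, h2, h3,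
      mul_neg, mul_neg, hterm, hterm]
    push_cast
    ring
  rw [Real.rpow_def_of_pos two_pos, binEntropyTwo_eq]
  have h2 : Real.log 2 ≠ 0 := (Real.log_pos one_lt_two).ne'
  rw [show Real.log 2 * (((k + l : ℕ) : ℝ) * (Real.binEntropy (k / ((k + l : ℕ) : ℝ)) / Real.log 2))
      = (k + l) * Real.binEntropy (k / (k + l)) by push_cast; field_simp, hent,
    ← Real.le_log_iff_exp_le (by positivity),
    Real.log_mul (by positivity) hC.ne']
  push_cast at hlog ⊢
  linarith

/-! ### Covering codes -/

/-- Greedy covering: as every point is related to at least `V` points, some point is related to a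
fraction `V / card α` of those not yet covered. -/
theorem exists_card_uncovered_mul_pow_le {α : Type*} [Fintype α] [Nonempty α]
    (r : α → α → Prop) [DecidableRel r] (V : ℕ)
    (hV : ∀ y, V ≤ (Finset.univ.filter fun x => r x y).card) (t : ℕ) :
    ∃ c : Fin t → α, (Finset.univ.filter fun y => ∀ j, ¬ r (c j) y).card * Fintype.card α ^ t ≤
      Fintype.card α * (Fintype.card α - V) ^ t := by
  induction t with
  | zero => exact ⟨Fin.elim0, by simp⟩
  | succ t ih =>
    obtain ⟨c, hc⟩ := ih
    set S := Finset.univ.filter fun y => ∀ j, ¬ r (c j) y with hS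
    have hsum : ∑ _x : α, S.card * V ≤
        ∑ x : α, Fintype.card α * (S.filter fun y => r x y).card := by
      rw [← Finset.mul_sum (a := Fintype.card α)]
      have : ∑ x : α, (S.filter fun y => r x y).card =
          ∑ y ∈ S, (Finset.univ.filter fun x => r x y).card :=
        Finset.sum_card_bipartiteAbove_eq_sum_card_bipartiteBelow r
      rw [this, Finset.sum_const, Finset.card_univ, smul_eq_mul]
      refine Nat.mul_le_mul_left _ ?_
      rw [← smul_eq_mul]
      exact Finset.card_nsmul_le_sum _ _ _ fun y _ => hV y
    obtain ⟨x, -, hx⟩ := Finset.exists_le_of_sum_le Finset.univ_nonempty hsum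
    refine ⟨Fin.snoc c x, ?_⟩
    have hS' : (Finset.univ.filter fun y => ∀ j, ¬ r (Fin.snoc (α := fun _ => α) c x j) y) =
        S.filter fun y => ¬ r x y := by
      ext y
      simp [hS, Fin.forall_fin_succ']
    rw [hS']
    have hadd : (S.filter fun y => r x y).card + (S.filter fun y => ¬ r x y).card = S.card :=
      Finset.card_filter_add_card_filter_not _
    have hle : (S.filter fun y => ¬ r x y).card * Fintype.card α ≤
        S.card * (Fintype.card α - V) := by
      rw [Nat.mul_sub, ← hadd, add_mul]
      rw [← hadd] at hx
      have := Nat.mul_comm (Fintype.card α) (S.filter fun y => r x y).card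
      omega
    calc _ = ((S.filter fun y => ¬ r x y).card * Fintype.card α) * Fintype.card α ^ t := by ring
      _ ≤ (S.card * (Fintype.card α - V)) * Fintype.card α ^ t := Nat.mul_le_mul_right _ hle
      _ = (S.card * Fintype.card α ^ t) * (Fintype.card α - V) := by ring
      _ ≤ (Fintype.card α * (Fintype.card α - V) ^ t) * (Fintype.card α - V) :=
        Nat.mul_le_mul_right _ hc
      _ = _ := by ring

theorem exists_cover_of_log_lt {α ι : Type*} [Fintype α] [Nonempty α] [Fintype ι]
    (r : α → α → Prop) [DecidableRel r] (V : ℕ)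
    (hV : ∀ y, V ≤ (Finset.univ.filter fun x => r x y).card)
    (h : (Fintype.card α : ℝ) * Real.log (Fintype.card α) < Fintype.card ι * V) :
    ∃ c : ι → α, ∀ y, ∃ j, r (c j) y := by
  obtain ⟨c, hc⟩ := exists_card_uncovered_mul_pow_le r V hV (Fintype.card ι)
  refine ⟨fun j => c (Fintype.equivFin ι j), ?_⟩
  by_contra! hcon
  obtain ⟨y, hy⟩ := hcon
  have hpos : 1 ≤ (Finset.univ.filter fun y => ∀ j, ¬ r (c j) y).card := by
    refine Finset.card_pos.2 ⟨y, ?_⟩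
    simp only [Finset.mem_filter, Finset.mem_univ, true_and]
    intro j
    simpa using hy ((Fintype.equivFin ι).symm j)
  have hVN : V ≤ Fintype.card α :=
    (hV y).trans (Finset.card_le_univ _)
  have hc' := (Nat.le_mul_of_pos_left (Fintype.card α ^ Fintype.card ι) hpos).trans hc
  have hN : (0 : ℝ) < Fintype.card α := by exact_mod_cast Fintype.card_pos
  set N := Fintype.card α
  set t := Fintype.card ι
  have hcR : (N : ℝ) ^ t ≤ N * ((N : ℝ) - V) ^ t := by
    have : ((N ^ t : ℕ) : ℝ) ≤ ((N * (N - V) ^ t : ℕ) : ℝ) := by exact_mod_cast hc'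
    rwa [Nat.cast_mul, Nat.cast_pow, Nat.cast_pow, Nat.cast_sub hVN] at this
  have hexp : (N : ℝ) - V ≤ N * Real.exp (-(V / N)) := by
    have h1 := Real.add_one_le_exp (-((V : ℝ) / N))
    have h2 := mul_le_mul_of_nonneg_left h1 hN.le
    have h3 : (N : ℝ) * (V / N) = V := by field_simp
    linarith [mul_add (N : ℝ) (-(V / N)) 1]
  have h0 : (0 : ℝ) ≤ (N : ℝ) - V := sub_nonneg.2 (by exact_mod_cast hVN)
  have h1 : (N : ℝ) ^ t ≤ N * ((N : ℝ) ^ t * Real.exp (-(t * (V / N)))) := by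
    refine hcR.trans (mul_le_mul_of_nonneg_left ((pow_le_pow_left₀ h0 hexp t).trans ?_) hN.le)
    rw [mul_pow, ← Real.exp_nat_mul, mul_neg]
  have h2 : Real.exp (t * (V / N)) ≤ N := by
    have hNt : (0 : ℝ) < (N : ℝ) ^ t := by positivity
    rw [Real.exp_neg] at h1
    have h3 : (N : ℝ) ^ t * 1 ≤ (N : ℝ) ^ t * (N / Real.exp (t * (V / N))) := by
      calc _ = (N : ℝ) ^ t := mul_one _
        _ ≤ _ := h1
        _ = _ := by ring
    have h4 := le_of_mul_le_mul_left h3 hNt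
    rwa [le_div_iff₀ (Real.exp_pos _), one_mul] at h4
  have h3 := (Real.le_log_iff_exp_le hN).2 h2
  have h4 : (t : ℝ) * (V / N) * N ≤ Real.log N * N := mul_le_mul_of_nonneg_right h3 hN.le
  have h5 : (t : ℝ) * (V / N) * N = t * V := by field_simp
  linarith [mul_comm (N : ℝ) (Real.log N)]

theorem choose_le_card_hammingBall {m : ℕ} (k : ℕ) (y : Fin m → Bool) :
    m.choose k ≤ (Finset.univ.filter fun x : Fin m → Bool => hammingDist x y ≤ k).card := by
  have h : (Finset.powersetCard k (Finset.univ : Finset (Fin m))).card = m.choose k := by simp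
  rw [← h]
  refine Finset.card_le_card_of_injOn (fun S i => xor (decide (i ∈ S)) (y i)) ?_ ?_
  · intro S hS
    have hcard := (Finset.mem_powersetCard.1 hS).2
    simp only [Finset.coe_filter, Finset.mem_univ, true_and, Set.mem_ofPred_eq]
    rw [← hcard, hammingDist]
    refine Finset.card_le_card fun i hi => ?_
    by_contra hiS
    simp [hiS] at hi
  · intro S _ T _ hST
    ext i
    have := congrFun hST i
    simpa using this

open Filter Topology in
/-- Covering codes of radius `p m` and rate close to `1 - H(p)`; the code words are indexed by the
strings of `b` bits. The term `+ 1` makes room for a delimiting bit. -/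
theorem exists_coveringCode {p : ℝ} (hp₀ : 0 ≤ p) (hp₁ : p ≤ 1) {δ : ℝ} (hδ : 0 < δ) :
    ∃ (m b : ℕ) (c : (Fin b → Bool) → (Fin m → Bool)), 0 < m ∧
      (b : ℝ) + 1 ≤ (1 - binEntropyTwo p + δ) * m ∧
      ∀ y, ∃ a, (hammingDist (c a) y : ℝ) ≤ p * m := by
  have hcont : Continuous binEntropyTwo := by
    rw [show binEntropyTwo = fun p => Real.binEntropy p / Real.log 2 from funext binEntropyTwo_eq]
    fun_prop
  have hfloor : Tendsto (fun m : ℕ => (⌊p * m⌋₊ : ℝ) / m) atTop (𝓝 p) :=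
    (tendsto_nat_floor_mul_div_atTop hp₀).comp tendsto_natCast_atTop_atTop
  have hlogm : Tendsto (fun m : ℕ => Real.log m / m) atTop (𝓝 0) :=
    (Real.isLittleO_log_id_atTop.tendsto_div_nhds_zero).comp tendsto_natCast_atTop_atTop
  have hinv : Tendsto (fun m : ℕ => (1 : ℝ) / m) atTop (𝓝 0) := tendsto_one_div_atTop_nhds_zero_nat
  have hlim : Tendsto (fun m : ℕ => (1 - binEntropyTwo ((⌊p * m⌋₊ : ℝ) / m))
      + (2 / Real.log 2) * (Real.log m / m) + 3 * (1 / m)) atTop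
      (𝓝 (1 - binEntropyTwo p + (2 / Real.log 2) * 0 + 3 * 0)) :=
    ((((hcont.tendsto p).comp hfloor).const_sub 1).add (hlogm.const_mul _)).add (hinv.const_mul 3)
  have hev := hlim.eventually_lt_const (u := 1 - binEntropyTwo p + δ) (by linarith)
  obtain ⟨m, hm, hm0⟩ := (hev.and (eventually_gt_atTop 0)).exists
  have hmR : (0 : ℝ) < m := by exact_mod_cast hm0
  have hm1 : (1 : ℝ) ≤ m := by exact_mod_cast hm0
  set k := ⌊p * m⌋₊ with hk
  have hkp : (k : ℝ) ≤ p * m := Nat.floor_le (by positivity)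
  have hkm : k ≤ m := by
    have : (k : ℝ) ≤ m := hkp.trans (by nlinarith)
    exact_mod_cast this
  have hl2 : 0 < Real.log 2 := Real.log_pos one_lt_two
  set h := binEntropyTwo ((k : ℝ) / m) with hh
  -- `2 ^ e = 2 m² 2 ^ (m - m h)` words suffice for the greedy argument.
  set e : ℝ := m * (1 - h) + (1 + 2 * Real.logb 2 m) with he
  have hh1 : h ≤ 1 := by
    rw [hh, binEntropyTwo_eq, div_le_one hl2]
    exact Real.binEntropy_le_log_two
  have he0 : 0 ≤ e := by
    have := Real.logb_nonneg one_lt_two hm1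
    have := mul_nonneg hmR.le (sub_nonneg.2 hh1)
    linarith
  have hcard : Fintype.card (Fin m → Bool) = 2 ^ m := by simp
  have hpow : (2 : ℝ) ^ e = 2 ^ m * 2 * (m : ℝ) ^ 2 / 2 ^ ((m : ℝ) * h) := by
    have : e = (m : ℝ) + 1 + Real.logb 2 m * (2 : ℕ) - m * h := by rw [he]; push_cast; ring
    rw [this, Real.rpow_sub two_pos, Real.rpow_add two_pos, Real.rpow_add two_pos,
      Real.rpow_mul_natCast two_pos.le, Real.rpow_logb two_pos (by norm_num) hmR,
      Real.rpow_natCast, Real.rpow_one]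
  obtain ⟨c, hc⟩ := exists_cover_of_log_lt (ι := Fin ⌈e⌉₊ → Bool)
    (fun x y : Fin m → Bool => hammingDist x y ≤ k) (m.choose k)
    (choose_le_card_hammingBall k) (by
      have hcb : (Fintype.card (Fin ⌈e⌉₊ → Bool) : ℝ) = 2 ^ ⌈e⌉₊ := by simp
      rw [hcard, hcb, Nat.cast_pow, Nat.cast_ofNat, Real.log_pow]
      have h1 := rpow_binEntropyTwo_le_mul_choose hm0 hkm
      rw [← hh] at h1
      have h2 : (2 : ℝ) ^ e ≤ 2 ^ ⌈e⌉₊ := by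
        rw [← Real.rpow_natCast]
        exact Real.rpow_le_rpow_of_exponent_le one_le_two (Nat.le_ceil e)
      have hE : (0 : ℝ) < 2 ^ ((m : ℝ) * h) := by positivity
      have h3 : (2 : ℝ) ^ e * 2 ^ ((m : ℝ) * h) = 2 ^ m * 2 * (m : ℝ) ^ 2 := by
        rw [hpow]; field_simp
      have h4 : (m : ℝ) + 1 ≤ 2 * m := by linarith
      have hC : (0 : ℝ) < m.choose k := by exact_mod_cast Nat.choose_pos hkm
      have h5 : (2 : ℝ) ^ m * 2 * (m : ℝ) ^ 2 ≤ 2 ^ ⌈e⌉₊ * (2 * m * m.choose k) := by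
        rw [← h3]
        exact mul_le_mul h2 (h1.trans (mul_le_mul_of_nonneg_right h4 hC.le)) hE.le (by positivity)
      have h6 : (2 : ℝ) ^ m * m ≤ 2 ^ ⌈e⌉₊ * m.choose k := by
        refine le_of_mul_le_mul_left (a := 2 * (m : ℝ)) ?_ (by positivity)
        linarith
      have h7 : (2 : ℝ) ^ m * (m * Real.log 2) < 2 ^ m * m := by
        have : Real.log 2 < 1 := by linarith [Real.log_two_lt_d9]
        have : (m : ℝ) * Real.log 2 < m := by nlinarith
        exact mul_lt_mul_of_pos_left this (by positivity)
      linarith)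
  refine ⟨m, ⌈e⌉₊, c, hm0, ?_, fun y => ?_⟩
  · have h1 := Nat.ceil_lt_add_one he0
    have h2 := mul_le_mul_of_nonneg_right hm.le hmR.le
    have h3 : ((1 - h) + (2 / Real.log 2) * (Real.log m / m) + 3 * (1 / m)) * m = e + 2 := by
      rw [he, Real.logb]; field_simp; ring
    linarith
  · obtain ⟨a, ha⟩ := hc y
    exact ⟨a, le_trans (by exact_mod_cast ha) hkp⟩

/-! ### Complexity of concatenations of code words -/

/-- The self-delimiting code of a sequence of `b`-bit strings: every string is preceded by the bit
`1`, and the bit `0` marks the end. -/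
def delimitedCode {b : ℕ} (w : List (Fin b → Bool)) : List Bool :=
  w.flatMap (fun v => true :: List.ofFn v) ++ [false]

theorem length_delimitedCode {b : ℕ} (w : List (Fin b → Bool)) :
    (delimitedCode w).length = w.length * (b + 1) + 1 := by
  simp [delimitedCode, List.length_flatMap]

theorem delimitedCode_cons {b : ℕ} (v : Fin b → Bool) (w : List (Fin b → Bool)) :
    delimitedCode (v :: w) = true :: (List.ofFn v ++ delimitedCode w) := by
  simp [delimitedCode]

theorem eq_of_delimitedCode_prefix {b : ℕ} {w w' : List (Fin b → Bool)}
    (h : delimitedCode w <+: delimitedCode w') : w = w' := by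
  induction w generalizing w' with
  | nil =>
    cases w' with
    | nil => rfl
    | cons v' w' => simp [delimitedCode] at h
  | cons v w ih =>
    cases w' with
    | nil => simp [delimitedCode] at h
    | cons v' w' =>
      rw [delimitedCode_cons, delimitedCode_cons, List.cons_prefix_cons] at h
      obtain ⟨t, ht⟩ := h.2
      rw [List.append_assoc] at ht
      obtain ⟨h1, h2⟩ := List.append_inj ht (by simp)
      rw [List.ofFn_injective h1, ih ⟨t, h2⟩]

theorem primrec_delimitedCode {b : ℕ} :
    Primrec (delimitedCode : List (Fin b → Bool) → List Bool) :=
  Primrec.list_append.comp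
    (Primrec.list_flatMap Primrec.id
      ((Primrec.dom_finite fun v : Fin b → Bool => true :: List.ofFn v).comp Primrec.snd).to₂)
    (Primrec.const [false])

/-- The machine with the string `τ` and the code book `c` built in: on the self-delimiting code of
`w` it returns `τ` followed by the code words with indices in `w`. The decoding is by search. -/
def codebookMachine {b : ℕ} (τ : List Bool) (c : (Fin b → Bool) → List Bool) :
    List Bool →. List Bool := fun l =>
  -- Instance search would find another `Encodable` instance, not the one of `Primcodable`.
  Nat.rfindOpt fun n =>
    (@Encodable.decode (List (Fin b → Bool)) Primcodable.toEncodable n).bind fun w =>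
      if delimitedCode w = l then some (τ ++ w.flatMap c) else none

theorem mem_codebookMachine {b : ℕ} {τ : List Bool} {c : (Fin b → Bool) → List Bool}
    {l σ : List Bool} (h : σ ∈ codebookMachine τ c l) :
    ∃ w, delimitedCode w = l ∧ σ = τ ++ w.flatMap c := by
  obtain ⟨n, hn⟩ := Nat.rfindOpt_spec h
  obtain ⟨w, -, hw⟩ := Option.bind_eq_some_iff.1 hn
  split_ifs at hw with hl
  exact ⟨w, hl, (Option.some.inj hw).symm⟩

theorem codebookMachine_delimitedCode {b : ℕ} (τ : List Bool) (c : (Fin b → Bool) → List Bool)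
    (w : List (Fin b → Bool)) : τ ++ w.flatMap c ∈ codebookMachine τ c (delimitedCode w) := by
  have hd : (codebookMachine τ c (delimitedCode w)).Dom :=
    Nat.rfindOpt_dom.2 ⟨@Encodable.encode _ Primcodable.toEncodable w, τ ++ w.flatMap c, by simp⟩
  obtain ⟨σ, hσ⟩ := Part.dom_iff_mem.1 hd
  obtain ⟨w', hw', rfl⟩ := mem_codebookMachine hσ
  rwa [eq_of_delimitedCode_prefix (hw' ▸ List.prefix_rfl : delimitedCode w' <+: delimitedCode w)]
    at hσ

theorem isPrefixFreeMachine_codebookMachine {b : ℕ} (τ : List Bool)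
    (c : (Fin b → Bool) → List Bool) : IsPrefixFreeMachine (codebookMachine τ c) where
  partrec := by
    have hout : Primrec fun w : List (Fin b → Bool) => τ ++ w.flatMap c :=
      Primrec.list_append.comp (Primrec.const τ)
        (Primrec.list_flatMap Primrec.id ((Primrec.dom_finite c).comp Primrec.snd).to₂)
    refine Partrec.rfindOpt (Primrec.to_comp ?_)
    refine Primrec.option_bind (Primrec.decode.comp Primrec.snd) ?_
    exact Primrec.ite
      (Primrec.eq.comp (primrec_delimitedCode.comp Primrec.snd) (Primrec.fst.comp Primrec.fst))
      (Primrec.option_some.comp (hout.comp Primrec.snd)) (Primrec.const none)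
  prefixFree := by
    intro l l' hl hl' h
    obtain ⟨σ, hσ⟩ := Part.dom_iff_mem.1 hl
    obtain ⟨σ', hσ'⟩ := Part.dom_iff_mem.1 hl'
    obtain ⟨w, rfl, -⟩ := mem_codebookMachine hσ
    obtain ⟨w', rfl, -⟩ := mem_codebookMachine hσ'
    rw [eq_of_delimitedCode_prefix h]

/-- The additive constant depends on `τ` and on the code book, but not on the number of code
words. -/
theorem exists_machineComplexity_append_flatMap_le {U : List Bool →. List Bool}
    (hU : IsOptimalPrefixFreeMachine U) {b : ℕ} (τ : List Bool) (c : (Fin b → Bool) → List Bool) :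
    ∃ C : ℕ, ∀ w : List (Fin b → Bool),
      machineComplexity U (τ ++ w.flatMap c) ≤ ((w.length * (b + 1) + C : ℕ) : ℕ∞) := by
  obtain ⟨C, hC⟩ := hU.optimal _ (isPrefixFreeMachine_codebookMachine τ c)
  refine ⟨1 + C, fun w => (hC _).trans ?_⟩
  have h : machineComplexity (codebookMachine τ c) (τ ++ w.flatMap c) ≤
      ((delimitedCode w).length : ℕ∞) :=
    iInf₂_le (delimitedCode w) (codebookMachine_delimitedCode τ c w)
  rw [length_delimitedCode] at h
  refine (add_le_add_left h (C : ℕ∞)).trans (le_of_eq ?_)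
  push_cast
  ring

/-! ### Blockwise quantization -/

theorem hammingDist_bitPrefix (X Y : ℕ → Bool) (n : ℕ) :
    hammingDist (bitPrefix X n) (bitPrefix Y n) = Nat.count (fun i => X i ≠ Y i) n := by
  rw [hammingDist, Nat.count_eq_card_filter_range, Finset.card_filter, Finset.card_filter,
    Finset.sum_range]
  rfl

theorem ofFn_bitPrefix_add (X : ℕ → Bool) (n m : ℕ) :
    List.ofFn (bitPrefix X (n + m)) =
      List.ofFn (bitPrefix X n) ++ List.ofFn (bitPrefix (fun i => X (n + i)) m) := by
  rw [List.ofFn_add]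
  rfl

/-- Beyond the position `N`, the sequence `X` is replaced by code words that are close to the
blocks of `Y` of length `m`. The first `N` bits and the code book only contribute a constant to the
complexity, and the fraction `p` of errors is exceeded only inside a block, by at most `m` errors. -/
theorem exists_blockwise_codeword {U : List Bool →. List Bool} (hU : IsOptimalPrefixFreeMachine U)
    {p : ℝ} (hp : 0 ≤ p) {m b : ℕ} (hm : 0 < m) (c : (Fin b → Bool) → (Fin m → Bool))
    (hc : ∀ y, ∃ a, (hammingDist (c a) y : ℝ) ≤ p * m) (X Y : ℕ → Bool) (N : ℕ)
    (hN : (Nat.count (fun i => X i ≠ Y i) N : ℝ) ≤ p * N) :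
    ∃ X' : ℕ → Bool, (∀ i < N, X' i = X i) ∧
      (∀ q : ℕ, (Nat.count (fun i => X' i ≠ Y i) (N + q * m) : ℝ) ≤ p * (N + q * m : ℕ)) ∧
      (∀ n, N ≤ n → (Nat.count (fun i => X' i ≠ Y i) n : ℝ) ≤ p * n + m) ∧
      ∃ C : ℕ, ∀ q : ℕ, machineComplexity U (List.ofFn (bitPrefix X' (N + q * m))) ≤
        ((q * (b + 1) + C : ℕ) : ℕ∞) := by
  choose a ha using fun q : ℕ => hc (bitPrefix (fun i => Y (N + q * m + i)) m)
  set X' : ℕ → Bool := fun i =>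
    if i < N then X i else c (a ((i - N) / m)) ⟨(i - N) % m, Nat.mod_lt _ hm⟩ with hX'
  have hlow : ∀ i < N, X' i = X i := fun i hi => by simp [hX', hi]
  have hblock : ∀ q, bitPrefix (fun i => X' (N + q * m + i)) m = c (a q) := by
    intro q
    ext r
    have h1 : ¬ N + q * m + (r : ℕ) < N := by omega
    have h2 : N + q * m + (r : ℕ) - N = r + m * q := by
      rw [Nat.mul_comm m q]; omega
    have h3 : (r + m * q) / m = q := by
      rw [Nat.add_mul_div_left _ _ hm, Nat.div_eq_of_lt r.2, zero_add]
    have h4 : (r + m * q) % m = r := by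
      rw [Nat.add_mul_mod_self_left, Nat.mod_eq_of_lt r.2]
    simp only [bitPrefix, hX', if_neg h1, h2, h3, h4]
  have hcount : ∀ q, (Nat.count (fun i => X' i ≠ Y i) (N + q * m) : ℝ) ≤
      p * (N + q * m : ℕ) := by
    intro q
    induction q with
    | zero =>
      have : Nat.count (fun i => X' i ≠ Y i) N = Nat.count (fun i => X i ≠ Y i) N := by
        rw [Nat.count_eq_card_filter_range, Nat.count_eq_card_filter_range]
        congr 1
        refine Finset.filter_congr fun i hi => ?_
        rw [hlow i (Finset.mem_range.1 hi)]
      simpa [this] using hN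
    | succ q ih =>
      have h := ha q
      rw [← hblock q, hammingDist_bitPrefix] at h
      rw [Nat.succ_mul, ← Nat.add_assoc, Nat.count_add]
      push_cast at ih ⊢
      linarith
  refine ⟨X', hlow, hcount, fun n hn => ?_, ?_⟩
  · -- The last block may be incomplete; it contributes at most `m` errors.
    have hdiv := Nat.div_add_mod (n - N) m
    have hmod := Nat.mod_lt (n - N) hm
    have hn' : n = N + (n - N) / m * m + (n - N) % m := by
      rw [Nat.mul_comm ((n - N) / m)]; omega
    have h1 := hcount ((n - N) / m)
    have h2 : Nat.count (fun i => X' i ≠ Y i) n ≤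
        Nat.count (fun i => X' i ≠ Y i) (N + (n - N) / m * m) + m := by
      conv_lhs => rw [hn', Nat.count_add]
      exact Nat.add_le_add_left ((Nat.count_le _).trans hmod.le) _
    have h3 : ((N + (n - N) / m * m : ℕ) : ℝ) ≤ n := by
      exact_mod_cast (by omega : N + (n - N) / m * m ≤ n)
    have h4 := mul_le_mul_of_nonneg_left h3 hp
    have h5 : (Nat.count (fun i => X' i ≠ Y i) n : ℝ) ≤
        Nat.count (fun i => X' i ≠ Y i) (N + (n - N) / m * m) + m := by exact_mod_cast h2
    linarith
  · obtain ⟨C, hC⟩ := exists_machineComplexity_append_flatMap_le hU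
      (List.ofFn (bitPrefix X' N)) (fun v => List.ofFn (c v))
    refine ⟨C, fun q => ?_⟩
    have hlist : List.ofFn (bitPrefix X' (N + q * m)) = List.ofFn (bitPrefix X' N) ++
        ((List.range q).map a).flatMap fun v => List.ofFn (c v) := by
      induction q with
      | zero => rw [Nat.zero_mul, Nat.add_zero, List.range_zero, List.map_nil, List.flatMap_nil,
          List.append_nil]
      | succ q ih =>
        rw [show N + (q + 1) * m = N + q * m + m by ring, ofFn_bitPrefix_add, ih, hblock,
          List.range_succ]
        simp
    rw [hlist]
    simpa using hC ((List.range q).map a)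

/-- Blockwise quantization continued up to a position `N' ≥ B` so late that the constant which
depends on the code and on the first `N` bits is absorbed by `δ N' / 2`. -/
theorem exists_extension {U : List Bool →. List Bool} (hU : IsOptimalPrefixFreeMachine U)
    {p s δ : ℝ} (hp : 0 ≤ p) (hδ : 0 < δ) {m b : ℕ} (hm : 0 < m)
    (hb : (b : ℝ) + 1 ≤ (s + δ / 2) * m) (c : (Fin b → Bool) → (Fin m → Bool))
    (hc : ∀ y, ∃ a, (hammingDist (c a) y : ℝ) ≤ p * m) (X Y : ℕ → Bool) (N B : ℕ)
    (hN : (Nat.count (fun i => X i ≠ Y i) N : ℝ) ≤ p * N) :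
    ∃ (X' : ℕ → Bool) (N' : ℕ), B ≤ N' ∧ N < N' ∧ (∀ i < N, X' i = X i) ∧
      (Nat.count (fun i => X' i ≠ Y i) N' : ℝ) ≤ p * N' ∧
      (∀ n, N ≤ n → (Nat.count (fun i => X' i ≠ Y i) n : ℝ) ≤ p * n + m) ∧
      ∃ K : ℕ, machineComplexity U (List.ofFn (bitPrefix X' N')) ≤ (K : ℕ∞) ∧
        (K : ℝ) ≤ (s + δ) * N' := by
  obtain ⟨X', hX, hcount, hn, C, hC⟩ := exists_blockwise_codeword hU hp hm c hc X Y N hN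
  have hm1 : (1 : ℝ) ≤ m := by exact_mod_cast hm
  have hs : 0 ≤ s + δ := by
    by_contra! h
    have : (s + δ / 2) * m ≤ 0 := mul_nonpos_of_nonpos_of_nonneg (by linarith) (by linarith)
    have : (0 : ℝ) ≤ b := Nat.cast_nonneg b
    linarith
  obtain ⟨q₀, hq₀⟩ := exists_nat_ge (C / (δ / 2))
  set q := max q₀ (B + 1) with hq
  have hqm : q ≤ q * m := Nat.le_mul_of_pos_right q hm
  refine ⟨X', N + q * m, ?_, ?_, hX, hcount q, hn, _, hC q, ?_⟩
  · have := le_max_right q₀ (B + 1); omega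
  · have := le_max_right q₀ (B + 1); omega
  · have h1 : (C : ℝ) ≤ δ / 2 * (q * m) := by
      have h2 : (q₀ : ℝ) ≤ q := by exact_mod_cast le_max_left q₀ (B + 1)
      have h3 : (q : ℝ) ≤ q * m := by exact_mod_cast hqm
      have h4 := (div_le_iff₀ (by positivity)).1 ((hq₀.trans h2).trans h3)
      linarith
    have h5 := mul_le_mul_of_nonneg_left hb (Nat.cast_nonneg (α := ℝ) q)
    have h6 : 0 ≤ (s + δ) * N := mul_nonneg hs (Nat.cast_nonneg N)
    push_cast
    nlinarith

/-! ### Passing to the limit -/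

theorem effectiveDim_le_of_tendsto {U : List Bool →. List Bool} {X : ℕ → Bool} {s : ℝ}
    {N K : ℕ → ℕ} (hNtop : Filter.Tendsto N Filter.atTop Filter.atTop) {δ : ℕ → ℝ}
    (hδ : Filter.Tendsto δ Filter.atTop (nhds 0))
    (hK : ∀ j, machineComplexity U (List.ofFn (bitPrefix X (N j))) ≤ (K j : ℕ∞))
    (hKs : ∀ j, (K j : ℝ) ≤ (s + δ j) * N j) :
    effectiveDim U X ≤ ENNReal.ofReal s := by
  have hlim : Filter.Tendsto (fun j => ENNReal.ofReal (s + δ j)) Filter.atTop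
      (nhds (ENNReal.ofReal s)) := by
    refine (ENNReal.continuous_ofReal.tendsto _).comp ?_
    simpa using hδ.const_add s
  rw [← hlim.liminf_eq, effectiveDim]
  refine (Filter.liminf_le_liminf_of_le hNtop).trans ?_
  rw [← Filter.liminf_comp]
  refine Filter.liminf_le_liminf ?_
  filter_upwards [hNtop.eventually_gt_atTop 0] with j hj
  have hNR : (0 : ℝ) < N j := by exact_mod_cast hj
  have h1 : ((machineComplexity U (List.ofFn (bitPrefix X (N j))) : ℕ∞) : ENNReal) ≤
      (K j : ENNReal) := by
    exact_mod_cast ENat.toENNReal_le.2 (hK j)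
  simp only [Function.comp_apply]
  refine (ENNReal.div_le_div_right h1 _).trans ?_
  rw [← ENNReal.ofReal_natCast, ← ENNReal.ofReal_natCast, ← ENNReal.ofReal_div_of_pos hNR]
  exact ENNReal.ofReal_le_ofReal ((div_le_iff₀ hNR).2 (hKs j))

theorem besicovitchDist_le_of_count_le {X Y : ℕ → Bool} {p : ℝ}
    (h : ∀ ε : ℝ, 0 < ε → ∀ᶠ n : ℕ in Filter.atTop,
      (Nat.count (fun i => X i ≠ Y i) n : ℝ) ≤ (p + ε) * n) :
    besicovitchDist X Y ≤ p := by
  refine le_of_forall_pos_le_add fun ε hε => ?_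
  refine Filter.limsup_le_of_le ?_ ?_
  · refine Filter.isCoboundedUnder_le_of_le Filter.atTop (x := 0) fun n => ?_
    exact div_nonneg (Nat.cast_nonneg _) (Nat.cast_nonneg _)
  · filter_upwards [h ε hε, Filter.eventually_gt_atTop 0] with n hn hn0
    rw [normalizedHammingDist, hammingDist_bitPrefix, div_le_iff₀ (by exact_mod_cast hn0)]
    exact hn

/-- If covering codes of radius `p m` and rate close to `s` exist, then so does a sequence of
dimension at most `s` at distance at most `p` from `Y`. -/
theorem exists_effectiveDim_le_besicovitchDist_le {U : List Bool →. List Bool}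
    (hU : IsOptimalPrefixFreeMachine U) {p s : ℝ} (hp : 0 ≤ p)
    (hcode : ∀ δ : ℝ, 0 < δ → ∃ (m b : ℕ) (c : (Fin b → Bool) → (Fin m → Bool)), 0 < m ∧
      (b : ℝ) + 1 ≤ (s + δ) * m ∧ ∀ y, ∃ a, (hammingDist (c a) y : ℝ) ≤ p * m)
    (Y : ℕ → Bool) :
    ∃ X : ℕ → Bool, effectiveDim U X ≤ ENNReal.ofReal s ∧ besicovitchDist X Y ≤ p := by
  set δ : ℕ → ℝ := fun j => 1 / ((j : ℝ) + 1) with hδdef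
  have hδ : ∀ j, 0 < δ j := fun j => by positivity
  have hδlim : Filter.Tendsto δ Filter.atTop (nhds 0) := tendsto_one_div_add_atTop_nhds_zero_nat
  choose m b c hm hb hc using fun j => hcode (δ j / 2) (half_pos (hδ j))
  let S := {x : (ℕ → Bool) × ℕ // (Nat.count (fun i => x.1 i ≠ Y i) x.2 : ℝ) ≤ p * x.2}
  -- Stage `j` ends so late that one block of the next stage is negligible from there on.
  have hstep : ∀ (j : ℕ) (x : S), ∃ x' : S, (j + 1) * m (j + 1) ≤ x'.1.2 ∧ x.1.2 < x'.1.2 ∧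
      (∀ i < x.1.2, x'.1.1 i = x.1.1 i) ∧
      (∀ n, x.1.2 ≤ n → (Nat.count (fun i => x'.1.1 i ≠ Y i) n : ℝ) ≤ p * n + m j) ∧
      ∃ K : ℕ, machineComplexity U (List.ofFn (bitPrefix x'.1.1 x'.1.2)) ≤ (K : ℕ∞) ∧
        (K : ℝ) ≤ (s + δ j) * x'.1.2 := by
    intro j x
    obtain ⟨X', N', h1, h2, h3, h4, h5⟩ := exists_extension hU hp (hδ j) (hm j) (hb j) (c j) (hc j)
      x.1.1 Y x.1.2 ((j + 1) * m (j + 1)) x.2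
    exact ⟨⟨(X', N'), h4⟩, h1, h2, h3, h5⟩
  choose f hfB hfN hfX hfn K hK hKs using hstep
  let x : ℕ → S := fun j => Nat.rec ⟨(Y, 0), by simp⟩ f j
  have hx : ∀ j, x (j + 1) = f j (x j) := fun j => rfl
  have hNmono : StrictMono fun j => (x j).1.2 :=
    strictMono_nat_of_lt_succ fun j => by rw [hx]; exact hfN j (x j)
  have hagree : ∀ i j k, j ≤ k → i < (x j).1.2 → (x k).1.1 i = (x j).1.1 i := by
    intro i j k hjk hi
    induction k, hjk using Nat.le_induction with
    | base => rfl
    | succ k hjk ih =>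
      rw [hx, hfX k (x k) i (hi.trans_le (hNmono.monotone hjk)), ih]
  set X : ℕ → Bool := fun i => (x (i + 1)).1.1 i with hXdef
  have hX : ∀ i j, i < (x j).1.2 → X i = (x j).1.1 i := by
    intro i j hi
    have hi' : i < (x (i + 1)).1.2 := (Nat.lt_succ_self i).trans_le (hNmono.id_le (i + 1))
    rcases le_total j (i + 1) with h | h
    · exact hagree i j (i + 1) h hi
    · exact (hagree i (i + 1) j h hi').symm
  refine ⟨X, effectiveDim_le_of_tendsto (N := fun j => (x (j + 1)).1.2) (K := fun j => K j (x j))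
    (hNmono.tendsto_atTop.comp (Filter.tendsto_add_atTop_nat 1)) hδlim (fun j => ?_)
    (fun j => hKs j (x j)), besicovitchDist_le_of_count_le fun ε hε => ?_⟩
  · have : bitPrefix X (x (j + 1)).1.2 = bitPrefix (x (j + 1)).1.1 (x (j + 1)).1.2 :=
      funext fun i => hX i (j + 1) i.2
    simp only [this]
    exact hK j (x j)
  · obtain ⟨j₀, hj₀⟩ := exists_nat_gt (1 / ε)
    filter_upwards [Filter.eventually_ge_atTop (x (j₀ + 1)).1.2] with n hn
    -- The errors up to `n` are controlled by the stage `j + 1` that fills the position `n`.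
    obtain ⟨j, hjn, hnj⟩ : ∃ j, (x (j + 1)).1.2 ≤ n ∧ n < (x (j + 2)).1.2 ∧ j₀ ≤ j := by
      obtain ⟨d, hd⟩ : ∃ d, n < (x (j₀ + 1 + d)).1.2 :=
        ⟨n + 1, by
          have := hNmono.id_le (j₀ + 1 + (n + 1))
          simp only [id] at this
          omega⟩
      induction d with
      | zero => exact absurd hd (by simpa using hn)
      | succ d ih =>
        by_cases h : n < (x (j₀ + 1 + d)).1.2
        · exact ih h
        · refine ⟨j₀ + d, ?_, ?_, by omega⟩
          · rw [show j₀ + d + 1 = j₀ + 1 + d by omega]; omega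
          · rw [show j₀ + d + 2 = j₀ + 1 + (d + 1) by omega]; exact hd
    have hcount : Nat.count (fun i => X i ≠ Y i) n =
        Nat.count (fun i => (x (j + 2)).1.1 i ≠ Y i) n := by
      rw [Nat.count_eq_card_filter_range, Nat.count_eq_card_filter_range]
      congr 1
      refine Finset.filter_congr fun i hi => ?_
      rw [hX i (j + 2) ((Finset.mem_range.1 hi).trans hnj.1)]
    rw [hcount]
    have h1 := hfn (j + 1) (x (j + 1)) n hjn
    rw [← hx] at h1
    have h2 : (j + 1) * m (j + 1) ≤ n := by
      have := hfB j (x j)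
      rw [← hx] at this
      omega
    have h3 : ((j : ℝ) + 1) * m (j + 1) ≤ n := by exact_mod_cast h2
    have h4 : (m (j + 1) : ℝ) ≤ ε * n := by
      have h5 : 1 ≤ ε * ((j : ℝ) + 1) := by
        have h6 : (j₀ : ℝ) ≤ j := by exact_mod_cast hnj.2
        have := (div_lt_iff₀ hε).1 hj₀
        nlinarith
      have h7 := mul_le_mul_of_nonneg_left h3 hε.le
      have h8 := mul_le_mul_of_nonneg_right h5 (Nat.cast_nonneg (α := ℝ) (m (j + 1)))
      linarith
    linarith

theorem mainTheorem5 (U : List Bool →. List Bool) (hU : IsOptimalPrefixFreeMachine U)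
    (s : ℝ) (hs₀ : 0 ≤ s) (hs₁ : s ≤ 1) (Y : ℕ → Bool) :
    ∃ X : ℕ → Bool, effectiveDim U X ≤ ENNReal.ofReal s ∧
      besicovitchDist X Y ≤ binEntropyTwoInv (1 - s) := by
  have hmem : (1 - s) ∈ binEntropyTwo '' Set.Icc 0 (1 / 2) :=
    bijOn_binEntropyTwo.surjOn ⟨by linarith, by linarith⟩
  have hp : binEntropyTwoInv (1 - s) ∈ Set.Icc (0 : ℝ) (1 / 2) := Function.invFunOn_mem hmem
  have hH : binEntropyTwo (binEntropyTwoInv (1 - s)) = 1 - s := Function.invFunOn_eq hmem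
  refine exists_effectiveDim_le_besicovitchDist_le hU hp.1 (fun δ hδ => ?_) Y
  have h := exists_coveringCode hp.1 (by linarith [hp.2]) hδ
  rwa [hH, sub_sub_cancel] at h
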